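/- For $z\in\mathbb C$ and $t\ge 0$ let $\overline D_z(t)$ be the closed disc with centre $z$ and radius $t$, and put $\overline D(t)=\overline D_0(t)$. Let $r>0$ and let $\mu$ be a (positive, possibly infinite) Borel measure on $\overline D(r)\subset\mathbb C$, extended by zero to $\mathbb C$. For $z\in\mathbb C$ and $s>0$ put $$\mathsf N_z^{\mu}(s)=\int_0^s\frac{\mu(\overline D_z(t))}{t}\,dt\in[0,+\infty].$$ A meromorphic function on $\overline D(R)$ is a function meromorphic in a neighbourhood of $\overline D(R)$, not identically $\infty$; the function $\ln^+|f|$ takes the value $+\infty$ at the poles of $f$. Let $n(t,f)$ be the number of poles of $f$ in $\overline D(t)$, counted with multiplicity, and put $$N(t,f)=\int_0^t\frac{n(s,f)-n(0,f)}{s}\,ds+n(0,f)\ln t,\qquad T(R,f)=\frac1{2\pi}\int_0^{2\pi}\ln^+|f(Re^{i\theta})|\,d\theta+N(R,f).$$ Then the following two statements are equivalent. (I) There exist $r_0>0$ and $R>r$ such that $\sup_{z\in\overline D(R)}\mathsf N_z^{\mu}(r_0)<+\infty$. (II) For every $R>r$ and every meromorphic function $f$ on $\overline D(R)$, the function $\ln^+|f|$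 is $\mu$-summable (measurable with finite integral) and $$\int_{\overline D(r)}\ln^+|f|\,d\mu\le 5\,\frac{R+r}{R-r}\,\bigl(T(R,f)-N(r,f)\bigr)\Bigl(\mu(\overline D(r))+\sup_{z\in\overline D(R)}\mathsf N_z^{\mu}(r)\Bigr)<+\infty.$$ (Here $0\cdot\infty=0$, which matters only if $T(R,f)=N(r,f)$.) -/

import Mathlib

open MeasureTheory Metric
open scoped ENNReal

noncomputable section

namespace Nevanlinna

/-- The integrated radial counting function `N_z^μ(r) = ∫₀^r μ(D̄_z(t)) / t dt ∈ [0, ∞]` of a Borel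
measure `μ` on the complex plane. -/
def measureCounting (μ : Measure ℂ) (z : ℂ) (r : ℝ) : ℝ≥0∞ :=
  ∫⁻ t in Set.Ioc 0 r, μ (closedBall z t) / ENNReal.ofReal t

/-- The multiplicity of `z` as a pole of `f`; it is `0` if `z` is not a pole. -/
def poleMultiplicity (f : ℂ → ℂ) (z : ℂ) : ℕ :=
  (-(meromorphicOrderAt f z).untop₀).toNat

/-- `n(t, f)`: the number of poles of `f` in the closed disc of radius `t` centred at `0`, counted
with multiplicity. -/
def poleCount (t : ℝ) (f : ℂ → ℂ) : ℕ :=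
  ∑ᶠ z ∈ closedBall (0 : ℂ) t, poleMultiplicity f z

/-- `N(r, f) = ∫₀^r (n(t, f) - n(0, f)) / t dt + n(0, f) ln r`. -/
def poleCounting (r : ℝ) (f : ℂ → ℂ) : ℝ :=
  (∫ t in (0 : ℝ)..r, ((poleCount t f : ℝ) - (poleCount 0 f : ℝ)) / t)
    + (poleCount 0 f : ℝ) * Real.log r

/-- `T(R, f) = m(R, f) + N(R, f)`, where `m(R, f)` is the mean of `ln⁺|f|` over the circle of
radius `R` centred at `0`. -/
def nevanlinnaT (R : ℝ) (f : ℂ → ℂ) : ℝ :=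
  Real.circleAverage (fun z => Real.posLog ‖f z‖) 0 R + poleCounting R f

open Classical in
/-- `ln⁺|f|` as a function with values in `[0, ∞]`: it is `∞` at the poles of `f`, and at every
other point it is computed from the value of `f` there, after removing a removable singularity
(for a Mathlib-meromorphic function the pointwise value there may be arbitrary). -/
def logPlusAbs (f : ℂ → ℂ) (z : ℂ) : ℝ≥0∞ :=
  if meromorphicOrderAt f z < 0 then ∞
  else ENNReal.ofReal (Real.posLog ‖toMeromorphicNFAt f z z‖)

end Nevanlinna

end

/-! (I) ⇒ (II). Let `w` lie in the disc of radius `r`, off the zeros and poles of `f`. The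
Poisson–Jensen formula writes `log |f(w)|` as a Poisson integral of `log |f|` over the circle of
radius `R`, minus the Green functions `G(u, w) = log ‖canonicalFactor R u w‖` at the zeros, plus
those at the poles. Dropping the zeros and bounding the Poisson kernel by `K = (R + r) / (R - r)`
bounds `log⁺ |f(w)|` by `K` times the circle mean plus the sum of the Green functions at the poles
(`posLog_norm_toMeromorphicNFAt_le`).

On the other side, `T(R, f) - N(r, f)` is exactly the circle mean plus the sum of `log (R / max r
|u|)` over the poles `u` (`nevanlinnaT_sub_poleCounting`). The two match through the estimate `G(u,
w) ≤ 5 K log (R / max r |u|) (1 + log⁺ (r / |w - u|))` (`log_norm_canonicalFactor_le`). Integrating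
in `w` and using Tonelli, the last factor contributes at most the mass of the disc plus `N_u^μ(r)`
(`lintegral_posLog_le_measureCounting`), and `u` ranges over the disc of radius `R`.

Condition (I) makes `μ` finite and free of atoms, so poles are negligible, and its bound passes to
every radius and centre (`iSup_measureCounting_lt_top`).

(II) ⇒ (I). For the constant function `e` the difference `T - N` is `1`, so finiteness of the
right-hand side is already a bound on the supremum. -/

noncomputable section

namespace Nevanlinna

open Complex InnerProductSpace Real Filter Topology ComplexConjugate

/-! ### The Poisson integral of a circle-integrable function -/

/-- The Poisson integral of `g` over the circle of radius `R`, evaluated at `w`. -/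
def poissonIntegral (R : ℝ) (w : ℂ) (g : ℂ → ℝ) : ℝ :=
  circleAverage ((re ∘ herglotzRieszKernel 0 w) • g) 0 R

lemma continuousOn_re_herglotzRieszKernel {R : ℝ} {w : ℂ} (hw : w ∈ ball 0 R) :
    ContinuousOn (re ∘ herglotzRieszKernel 0 w) (sphere 0 |R|) :=
  continuous_re.comp_continuousOn (continuousOn_herglotzRieszKernel_sphere hw)

lemma poissonIntegral_add {R : ℝ} {w : ℂ} {g₁ g₂ : ℂ → ℝ} (hw : w ∈ ball 0 R)
    (h₁ : CircleIntegrable g₁ 0 R) (h₂ : CircleIntegrable g₂ 0 R) :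
    poissonIntegral R w (g₁ + g₂) = poissonIntegral R w g₁ + poissonIntegral R w g₂ := by
  rw [poissonIntegral, smul_add, circleAverage_add
    (h₁.continuousOn_smul (continuousOn_re_herglotzRieszKernel hw))
    (h₂.continuousOn_smul (continuousOn_re_herglotzRieszKernel hw))]
  rfl

lemma poissonIntegral_sum {R : ℝ} {w : ℂ} {ι : Type*} {s : Finset ι} {c : ι → ℝ} {g : ι → ℂ → ℝ}
    (hw : w ∈ ball 0 R) (h : ∀ i ∈ s, CircleIntegrable (g i) 0 R) :
    poissonIntegral R w (∑ i ∈ s, c i • g i) = ∑ i ∈ s, c i * poissonIntegral R w (g i) := by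
  simp only [poissonIntegral]
  rw [Finset.smul_sum, circleAverage_sum]
  · refine Finset.sum_congr rfl fun i _ ↦ ?_
    rw [smul_comm, circleAverage_smul, smul_eq_mul]
  · exact fun i hi ↦ ((h i hi).const_smul (a := c i)).continuousOn_smul
      (continuousOn_re_herglotzRieszKernel hw)

lemma poissonIntegral_congr {R : ℝ} {w : ℂ} {g₁ g₂ : ℂ → ℝ} (hR : 0 < R)
    (h : g₁ =ᶠ[codiscreteWithin (sphere 0 |R|)] g₂) :
    poissonIntegral R w g₁ = poissonIntegral R w g₂ := by
  refine circleAverage_congr_codiscreteWithin ?_ hR.ne'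
  filter_upwards [h] with z hz
  simp [hz]

/-- An upper bound for the Poisson integral by the circle average of a nonnegative majorant. -/
lemma poissonIntegral_le {r R : ℝ} {w : ℂ} {g₁ g₂ : ℂ → ℝ} (hrR : r < R)
    (hw : w ∈ closedBall 0 r) (h₁ : CircleIntegrable g₁ 0 R) (h₂ : CircleIntegrable g₂ 0 R)
    (h₀ : ∀ z, 0 ≤ g₂ z) (h : ∀ z, g₁ z ≤ g₂ z) :
    poissonIntegral R w g₁ ≤ (R + r) / (R - r) * circleAverage g₂ 0 R := by
  have hwr : ‖w‖ ≤ r := by simpa using hw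
  have hwR : w ∈ ball 0 R := by simpa using hwr.trans_lt hrR
  have hR : 0 < R := pos_of_mem_ball hwR
  rw [← smul_eq_mul, ← circleAverage_smul, poissonIntegral]
  refine circleAverage_mono (h₁.continuousOn_smul (continuousOn_re_herglotzRieszKernel hwR))
    h₂.const_smul fun z hz ↦ ?_
  rw [abs_of_pos hR] at hz
  have e₁ := re_herglotzRieszKernel_le hz hwR
  have e₂ := le_re_herglotzRieszKernel hz hwR
  simp only [Pi.smul_apply', Function.comp_apply, smul_eq_mul, Pi.smul_apply,
    herglotzRieszKernel_def]
  simp only [sub_zero] at e₁ e₂ ⊢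
  have hpos : 0 ≤ (R - ‖w‖) / (R + ‖w‖) :=
    div_nonneg (by linarith) (by positivity)
  have hle : (R + ‖w‖) / (R - ‖w‖) ≤ (R + r) / (R - r) := by
    apply div_le_div₀ <;> linarith [norm_nonneg w]
  calc _ ≤ ((z + w) / (z - w)).re * g₂ z :=
        mul_le_mul_of_nonneg_left (h z) (hpos.trans e₂)
    _ ≤ _ := mul_le_mul_of_nonneg_right (e₁.trans hle) (h₀ z)

/-! ### The Poisson–Jensen formula and the pointwise bound for `log⁺ |f|` -/

lemma norm_sq_sub_conj_mul_of_mem_sphere {R : ℝ} {u z : ℂ} (hz : ‖z‖ = R) :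
    ‖(R : ℂ) ^ 2 - conj u * z‖ = R * ‖z - u‖ := by
  have h : (R : ℂ) ^ 2 = conj z * z := by
    rw [← normSq_eq_conj_mul_self, normSq_eq_norm_sq, hz]; simp
  rw [h, ← sub_mul, ← map_sub, norm_mul, norm_conj, hz, mul_comm]

/-- Divided by `(R * ‖w - u‖) ^ 2`, this reads `|canonicalFactor|² = 1 + (a nonnegative term)` in
the closed disc, which yields both the sign of the Green function and its decay as `u` nears the
circle. -/
lemma norm_sq_sub_conj_mul (R : ℝ) (u w : ℂ) :
    ‖(R : ℂ) ^ 2 - conj u * w‖ ^ 2 =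
      (R * ‖w - u‖) ^ 2 + (R ^ 2 - ‖u‖ ^ 2) * (R ^ 2 - ‖w‖ ^ 2) := by
  simp only [mul_pow, ← normSq_eq_norm_sq, normSq_apply, sub_re, sub_im, mul_re, mul_im, conj_re,
    conj_im, ← ofReal_pow, ofReal_re, ofReal_im]
  ring

/-- The Poisson integral of `log ‖· - u‖` for `u` in the closed disc. -/
lemma poissonIntegral_log_norm_sub {R : ℝ} {u w : ℂ} (hw : w ∈ ball 0 R)
    (hu : u ∈ closedBall 0 R) :
    poissonIntegral R w (fun z ↦ Real.log ‖z - u‖) = Real.log (‖(R : ℂ) ^ 2 - conj u * w‖ / R) := by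
  have hR : 0 < R := pos_of_mem_ball hw
  have huR : ‖u‖ ≤ R := by simpa using hu
  rcases huR.lt_or_eq with hlt | heq
  · have hne : ∀ z ∈ closedBall (0 : ℂ) R, ((R : ℂ) ^ 2 - conj u * z) / R ≠ 0 := by
      intro z hz
      have hz' : ‖z‖ ≤ R := by simpa using hz
      refine div_ne_zero (fun h0 ↦ ?_) (by exact_mod_cast hR.ne')
      have := congrArg norm (sub_eq_zero.mp h0)
      simp only [norm_pow, norm_mul, norm_real, norm_conj, Real.norm_eq_abs, abs_of_pos hR] at this
      nlinarith [norm_nonneg u, norm_nonneg z]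
    -- On the circle `‖z - u‖` equals `‖R² - conj u * z‖ / R`, and the latter function has no zero
    -- in the closed disc, so its logarithm is harmonic there and is reproduced by the Poisson
    -- kernel.
    have hharm : HarmonicOnNhd (fun z : ℂ ↦ Real.log ‖((R : ℂ) ^ 2 - conj u * z) / R‖)
        (closedBall 0 R) := fun z hz ↦
      AnalyticAt.harmonicAt_log_norm (f := fun z : ℂ ↦ ((R : ℂ) ^ 2 - conj u * z) / R)
        (by fun_prop (disch := exact_mod_cast hR.ne')) (hne z hz)
    have key := hharm.circleAverage_re_herglotzRieszKernel_smul hw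
    rw [norm_div, norm_real, Real.norm_eq_abs, abs_of_pos hR] at key
    rw [← key, poissonIntegral]
    refine circleAverage_congr_sphere fun z hz ↦ ?_
    have hz' : ‖z‖ = R := by simpa [abs_of_pos hR] using hz
    simp only [Pi.smul_apply']
    rw [norm_div, norm_real, Real.norm_eq_abs, abs_of_pos hR,
      norm_sq_sub_conj_mul_of_mem_sphere hz', mul_div_cancel_left₀ _ hR.ne']
  · have h1 : ‖(R : ℂ) ^ 2 - conj u * w‖ = R * ‖w - u‖ := by
      rw [← norm_conj, map_sub, map_mul, conj_conj, map_pow, conj_ofReal, mul_comm,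
        norm_sq_sub_conj_mul_of_mem_sphere heq, norm_sub_rev]
    rw [h1, mul_div_cancel_left₀ _ hR.ne', poissonIntegral]
    exact circleAverage_re_herglotzRieszKernel_mul_log₀ (by simpa using heq) hw

lemma poissonIntegral_log_norm_of_ne_zero {R : ℝ} {w : ℂ} {g : ℂ → ℂ} (hw : w ∈ ball 0 R)
    (hg : AnalyticOnNhd ℂ g (closedBall 0 R)) (hg₀ : ∀ u ∈ closedBall 0 R, g u ≠ 0) :
    poissonIntegral R w (fun z ↦ Real.log ‖g z‖) = Real.log ‖g w‖ :=
  HarmonicOnNhd.circleAverage_re_herglotzRieszKernel_smul (f := fun z ↦ Real.log ‖g z‖)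
    (fun z hz ↦ (hg z hz).harmonicAt_log_norm (hg₀ z hz)) hw

/-- The finite set of zeros and poles of `f` in the closed disc of radius `R`. -/
def divisorSupport (R : ℝ) (f : ℂ → ℂ) : Finset ℂ :=
  ((MeromorphicOn.divisor f (closedBall 0 R)).finiteSupport (isCompact_closedBall 0 R)).toFinset

lemma mem_divisorSupport {R : ℝ} {f : ℂ → ℂ} {u : ℂ} :
    u ∈ divisorSupport R f ↔ MeromorphicOn.divisor f (closedBall 0 R) u ≠ 0 := by
  simp [divisorSupport]

lemma mem_closedBall_of_mem_divisorSupport {R : ℝ} {f : ℂ → ℂ} {u : ℂ}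
    (hu : u ∈ divisorSupport R f) : u ∈ closedBall 0 R :=
  (MeromorphicOn.divisor f (closedBall 0 R)).supportWithinDomain (mem_divisorSupport.1 hu)

/-- The **Poisson–Jensen formula** at a point that is neither a zero nor a pole. -/
theorem poissonIntegral_log_norm {R : ℝ} {w : ℂ} {f : ℂ → ℂ} (hw : w ∈ ball 0 R)
    (hf : MeromorphicOn f (closedBall 0 R)) (hw₀ : meromorphicOrderAt f w = 0) :
    poissonIntegral R w (fun z ↦ Real.log ‖f z‖) = Real.log ‖meromorphicTrailingCoeffAt f w‖ +
      ∑ u ∈ divisorSupport R f,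
        (MeromorphicOn.divisor f (closedBall 0 R) u : ℝ) * Real.log ‖canonicalFactor R u w‖ := by
  have hR : 0 < R := pos_of_mem_ball hw
  have hwc : w ∈ closedBall 0 R := ball_subset_closedBall hw
  set D := MeromorphicOn.divisor f (closedBall 0 R) with hD
  have hfin := D.finiteSupport (isCompact_closedBall 0 R)
  have htop : ∀ u : closedBall (0 : ℂ) R, meromorphicOrderAt f u ≠ ⊤ :=
    (hf.exists_meromorphicOrderAt_ne_top_iff_forall (isConnected_closedBall hR.le)).1
      ⟨⟨w, hwc⟩, by simp [hw₀]⟩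
  -- `f` is a finite product of powers of `z - u` times a zero-free analytic `g`. The identity holds
  -- off a discrete set, which suffices under the integral; at `w` itself the trailing coefficient
  -- replaces the value of `f`.
  obtain ⟨g, h₁g, h₂g, h₃g⟩ := hf.extract_zeros_poles htop hfin
  have hlog := MeromorphicOn.extract_zeros_poles_log h₂g h₃g
  have hacc : AccPt w (𝓟 (closedBall (0 : ℂ) R)) := by
    apply accPt_iff_frequently_nhdsNE.mpr
    apply compl_notMem
    exact mem_nhdsWithin_of_mem_nhds (closedBall_mem_nhds_of_mem hw)
  have htc := MeromorphicOn.log_norm_meromorphicTrailingCoeffAt_extract_zeros_poles hfin hwc hacc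
    (hf w hwc) (h₁g w hwc) (h₂g ⟨w, hwc⟩) h₃g
  rw [finsum_eq_sum_of_support_subset (s := divisorSupport R f) _ (by
    intro u hu
    have : D u ≠ 0 := fun h ↦ hu (by ext; simp [← hD, h])
    exact mem_divisorSupport.2 this)] at hlog
  rw [finsum_eq_sum_of_support_subset (s := divisorSupport R f) _ (by
    intro u hu
    have : D u ≠ 0 := fun h ↦ hu (by simp [h])
    exact mem_divisorSupport.2 this)] at htc
  have hsum : (∑ u ∈ divisorSupport R f, fun z : ℂ ↦ (D u : ℝ) * Real.log ‖z - u‖)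
      = ∑ u ∈ divisorSupport R f, (D u : ℝ) • fun z : ℂ ↦ Real.log ‖z - u‖ := rfl
  have hint : ∀ u : ℂ, CircleIntegrable (fun z ↦ Real.log ‖z - u‖) 0 R := fun u ↦
    MeromorphicOn.circleIntegrable_log_norm (f := fun z ↦ z - u) (fun z _ ↦ by fun_prop)
  have hsub : sphere (0 : ℂ) |R| ⊆ closedBall 0 R := by
    rw [abs_of_pos hR]; exact sphere_subset_closedBall
  rw [poissonIntegral_congr hR (codiscreteWithin_mono hsub hlog), hsum, poissonIntegral_add hw,
    poissonIntegral_sum hw (fun u _ ↦ hint u),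
    poissonIntegral_log_norm_of_ne_zero hw h₁g fun u hu ↦ h₂g ⟨u, hu⟩, htc, add_right_comm,
    ← Finset.sum_add_distrib]
  · congr 1
    refine Finset.sum_congr rfl fun u hu ↦ ?_
    have hDu : D u ≠ 0 := mem_divisorSupport.1 hu
    have huR : u ∈ closedBall 0 R := mem_closedBall_of_mem_divisorSupport hu
    have hwu : w ≠ u := by
      rintro rfl
      exact hDu (by rw [hD, MeromorphicOn.divisor_apply hf hwc, hw₀]; rfl)
    have hnum : (R : ℂ) ^ 2 - conj u * w ≠ 0 := by
      intro h0
      have := congrArg norm (sub_eq_zero.mp h0)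
      have huR' : ‖u‖ ≤ R := by simpa using huR
      have hwR' : ‖w‖ < R := by simpa using hw
      simp only [norm_pow, norm_mul, norm_real, norm_conj, Real.norm_eq_abs, abs_of_pos hR] at this
      nlinarith [norm_nonneg u, norm_nonneg w]
    rw [poissonIntegral_log_norm_sub hw huR, canonicalFactor_apply, norm_div, norm_mul, norm_real,
      Real.norm_eq_abs, abs_of_pos hR, ← div_div,
      Real.log_div (y := ‖w - u‖) (by positivity) (by simpa [sub_eq_zero] using hwu)]
    ring
  · exact CircleIntegrable.sum _ fun u _ ↦ (hint u).const_smul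
  · exact MeromorphicOn.circleIntegrable_log_norm fun z hz ↦ (h₁g z (hsub hz)).meromorphicAt

/-- By `norm_sq_sub_conj_mul` the numerator dominates the denominator. At `w = u` division by zero
gives `log 0 = 0`, so no exception is needed. -/
lemma log_norm_canonicalFactor_nonneg {R : ℝ} {u w : ℂ} (hR : 0 < R) (hw : ‖w‖ ≤ R)
    (hu : ‖u‖ ≤ R) : 0 ≤ Real.log ‖canonicalFactor R u w‖ := by
  rcases eq_or_ne w u with rfl | hwu
  · simp
  have hd : 0 < ‖w - u‖ := norm_pos_iff.2 (sub_ne_zero.2 hwu)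
  apply Real.log_nonneg
  rw [canonicalFactor_apply, norm_div, norm_mul, norm_real, Real.norm_eq_abs, abs_of_pos hR,
    one_le_div (by positivity)]
  refine abs_le_of_sq_le_sq' ?_ (norm_nonneg _) |>.2
  have := norm_sq_sub_conj_mul R u w
  nlinarith [mul_nonneg (by nlinarith [norm_nonneg u] : 0 ≤ R ^ 2 - ‖u‖ ^ 2)
    (by nlinarith [norm_nonneg w] : 0 ≤ R ^ 2 - ‖w‖ ^ 2)]

lemma meromorphicTrailingCoeffAt_eq_toMeromorphicNFAt {f : ℂ → ℂ} {w : ℂ} (hf : MeromorphicAt f w)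
    (hw : meromorphicOrderAt f w = 0) :
    meromorphicTrailingCoeffAt f w = toMeromorphicNFAt f w w := by
  have hne := hf.meromorphicOrderAt_eq_zero_iff_toMeromorphicNFAt_ne_zero.1 hw
  rw [meromorphicTrailingCoeffAt_congr_nhdsNE hf.eq_nhdsNE_toMeromorphicNFAt]
  exact AnalyticAt.meromorphicTrailingCoeffAt_of_ne_zero
    (hf.meromorphicOrderAt_nonneg_iff_analyticAt_toMeromorphicNFAt.1 hw.ge) hne

/-- Pointwise upper bound of `log⁺ |f|` by its circle average and by the Green functions with poles
at the poles of `f`. -/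
theorem posLog_norm_toMeromorphicNFAt_le {r R : ℝ} {w : ℂ} {f : ℂ → ℂ} (hrR : r < R)
    (hf : MeromorphicOn f (closedBall 0 R)) (hw : w ∈ closedBall 0 r) :
    Real.posLog ‖toMeromorphicNFAt f w w‖ ≤
      (R + r) / (R - r) * circleAverage (fun z ↦ Real.posLog ‖f z‖) 0 R +
        ∑ u ∈ divisorSupport R f, (poleMultiplicity f u : ℝ) * Real.log ‖canonicalFactor R u w‖ := by
  have hwr : ‖w‖ ≤ r := by simpa using hw
  have hr : 0 ≤ r := (norm_nonneg w).trans hwr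
  have hR : 0 < R := hr.trans_lt hrR
  have hwR : w ∈ ball 0 R := by simpa using hwr.trans_lt hrR
  have hwc := ball_subset_closedBall hwR
  have hG : ∀ u ∈ divisorSupport R f, 0 ≤ Real.log ‖canonicalFactor R u w‖ := fun u hu ↦
    log_norm_canonicalFactor_nonneg hR (hwr.trans hrR.le)
      (by simpa using mem_closedBall_of_mem_divisorSupport hu)
  have hnn : 0 ≤ (R + r) / (R - r) * circleAverage (fun z ↦ Real.posLog ‖f z‖) 0 R +
      ∑ u ∈ divisorSupport R f, (poleMultiplicity f u : ℝ) * Real.log ‖canonicalFactor R u w‖ := by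
    refine add_nonneg (mul_nonneg (div_nonneg (by linarith) (by linarith)) ?_)
      (Finset.sum_nonneg fun u hu ↦ mul_nonneg (Nat.cast_nonneg _) (hG u hu))
    exact circleAverage_nonneg_of_nonneg fun _ _ ↦ Real.posLog_nonneg
  by_cases hw₀ : meromorphicOrderAt f w = 0
  swap
  -- At a zero, at a pole and where `f` vanishes identically, the normal form takes the value `0`.
  · have : toMeromorphicNFAt f w w = 0 := by
      by_contra h
      exact hw₀ ((hf w hwc).meromorphicOrderAt_eq_zero_iff_toMeromorphicNFAt_ne_zero.2 h)
    simpa [this] using hnn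
  have hsph : MeromorphicOn f (sphere 0 |R|) :=
    hf.mono_set (by rw [abs_of_pos hR]; exact sphere_subset_closedBall)
  have hPJ := poissonIntegral_log_norm hwR hf hw₀
  have hle := poissonIntegral_le hrR hw hsph.circleIntegrable_log_norm
    hsph.circleIntegrable_posLog_norm (fun _ ↦ Real.posLog_nonneg) (fun z ↦ le_max_right _ _)
  rw [meromorphicTrailingCoeffAt_eq_toMeromorphicNFAt (hf w hwc) hw₀] at hPJ
  refine max_le hnn ?_
  -- Zeros enter with a nonpositive sign and are discarded: minus the divisor is at most the pole
  -- multiplicity.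
  have hsum : -∑ u ∈ divisorSupport R f,
      (MeromorphicOn.divisor f (closedBall 0 R) u : ℝ) * Real.log ‖canonicalFactor R u w‖ ≤
      ∑ u ∈ divisorSupport R f, (poleMultiplicity f u : ℝ) * Real.log ‖canonicalFactor R u w‖ := by
    rw [← Finset.sum_neg_distrib]
    refine Finset.sum_le_sum fun u hu ↦ ?_
    rw [← neg_mul]
    refine mul_le_mul_of_nonneg_right ?_ (hG u hu)
    rw [MeromorphicOn.divisor_apply hf (mem_closedBall_of_mem_divisorSupport hu), poleMultiplicity]
    exact_mod_cast Int.self_le_toNat _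
  linarith

/-! ### Upper bounds for the Green function of the disc -/

lemma two_mul_sub_div_add_le_log {M R : ℝ} (hM : 0 < M) (hMR : M ≤ R) :
    2 * (R - M) / (R + M) ≤ Real.log (R / M) := by
  have h := Real.le_log_one_add_of_nonneg (x := (R - M) / M) (div_nonneg (by linarith) hM.le)
  have e₁ : 1 + (R - M) / M = R / M := by field_simp; ring
  have e₂ : 2 * ((R - M) / M) / ((R - M) / M + 2) = 2 * (R - M) / (R + M) := by
    have h₁ : R + M ≠ 0 := by linarith
    have h₂ : (R - M) / M + 2 = (R + M) / M := by field_simp; ring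
    rw [h₂]
    field_simp
  rwa [e₁, e₂] at h

/-- For a pole near the circle, `w` stays away from `u`, so no singular factor is needed: `2 log x ≤
x² - 1`, with `x` the norm of the canonical factor, gives a bound linear in `R - ‖u‖`, which
`two_mul_sub_div_add_le_log` converts into `log (R / ‖u‖)`. The argument yields the constant `4`. -/
lemma log_norm_canonicalFactor_le_of_far {r R : ℝ} {u w : ℂ} (hrR : r < R) (hr : 0 < r)
    (hw : ‖w‖ ≤ r) (hu : ‖u‖ ≤ R) (hfar : (R + r) / 2 ≤ ‖u‖) :
    Real.log ‖canonicalFactor R u w‖ ≤ 5 * ((R + r) / (R - r)) * Real.log (R / ‖u‖) := by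
  have hR : 0 < R := hr.trans hrR
  have hu₀ : 0 < ‖u‖ := by linarith
  have hd : (R - ‖w‖) / 2 ≤ ‖w - u‖ := by
    have := norm_sub_norm_le u w
    rw [norm_sub_rev] at this
    linarith
  have hd₀ : 0 < ‖w - u‖ := by linarith
  have hA := two_mul_sub_div_add_le_log hu₀ hu
  have hX : ‖canonicalFactor R u w‖ ^ 2 =
      1 + (R ^ 2 - ‖u‖ ^ 2) * (R ^ 2 - ‖w‖ ^ 2) / (R * ‖w - u‖) ^ 2 := by
    rw [canonicalFactor_apply, norm_div, norm_mul, norm_real, Real.norm_eq_abs, abs_of_pos hR,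
      div_pow, norm_sq_sub_conj_mul]
    field_simp
  have hlog : 2 * Real.log ‖canonicalFactor R u w‖ ≤
      (R ^ 2 - ‖u‖ ^ 2) * (R ^ 2 - ‖w‖ ^ 2) / (R * ‖w - u‖) ^ 2 := by
    have hnn : 0 ≤ (R ^ 2 - ‖u‖ ^ 2) * (R ^ 2 - ‖w‖ ^ 2) / (R * ‖w - u‖) ^ 2 := by
      refine div_nonneg (mul_nonneg ?_ ?_) (by positivity) <;> nlinarith [norm_nonneg w]
    have h := Real.log_le_sub_one_of_pos (x := ‖canonicalFactor R u w‖ ^ 2)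
      (by rw [hX]; positivity)
    rw [Real.log_pow, hX] at h
    push_cast at h
    linarith
  have hbd : (R ^ 2 - ‖u‖ ^ 2) * (R ^ 2 - ‖w‖ ^ 2) / (R * ‖w - u‖) ^ 2 ≤
      8 * ((R + r) / (R - r)) * (2 * (R - ‖u‖) / (R + ‖u‖)) := by
    generalize ‖w - u‖ = d at *
    generalize ‖u‖ = ρ at *
    have hs := norm_nonneg w
    generalize ‖w‖ = s at *
    calc (R ^ 2 - ρ ^ 2) * (R ^ 2 - s ^ 2) / (R * d) ^ 2
        ≤ (R ^ 2 - ρ ^ 2) * (R ^ 2 - s ^ 2) / (R * ((R - s) / 2)) ^ 2 := by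
          have h₁ : 0 ≤ (R ^ 2 - ρ ^ 2) * (R ^ 2 - s ^ 2) := by
            apply mul_nonneg <;> nlinarith
          have h₂ : 0 < (R - s) / 2 := by linarith
          gcongr
      _ = 4 * ((R + s) / (R - s)) * ((R - ρ) / (R + ρ)) * ((R + ρ) / R) ^ 2 := by
          have h₁ : R - s ≠ 0 := by linarith
          have h₂ : R + ρ ≠ 0 := by linarith
          field_simp
          ring
      _ ≤ 4 * ((R + r) / (R - r)) * ((R - ρ) / (R + ρ)) * 2 ^ 2 := by
          have h₁ : 0 < R - s := by linarith
          have h₂ : 0 < R - r := by linarith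
          have h₃ : 0 ≤ (R - ρ) / (R + ρ) := div_nonneg (by linarith) (by linarith)
          have h₄ : (R + ρ) / R ≤ 2 := by rw [div_le_iff₀ hR]; linarith
          gcongr
      _ = _ := by ring
  have hK : 0 ≤ (R + r) / (R - r) := div_nonneg (by linarith) (by linarith)
  have hA₀ : 0 ≤ Real.log (R / ‖u‖) := Real.log_nonneg (by rwa [one_le_div hu₀])
  nlinarith [mul_le_mul_of_nonneg_left hA hK, mul_nonneg hK hA₀]

lemma log_four_lt : Real.log 4 < 8 / 3 := by
  have : Real.log 4 = 2 * Real.log 2 := by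
    rw [show (4 : ℝ) = 2 ^ 2 by norm_num, Real.log_pow]; norm_num
  linarith [Real.log_two_lt_d9]

/-- Here `log (R / max r ‖u‖)` is bounded below by `2 / (3 K)`, so it can absorb additive constants.
With `A` this logarithm, `G ≤ A + log 4 + log⁺ (r / ‖w - u‖)` and `log 4 < 8 / 3 ≤ 4 K A`; this is
the source of the `5`. -/
lemma log_norm_canonicalFactor_le_of_near {r R : ℝ} {u w : ℂ} (hrR : r < R) (hr : 0 < r)
    (hw : ‖w‖ ≤ r) (hnear : ‖u‖ ≤ (R + r) / 2) (hwu : w ≠ u) :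
    Real.log ‖canonicalFactor R u w‖ ≤ 5 * ((R + r) / (R - r)) * Real.log (R / max r ‖u‖) *
      (1 + Real.posLog (r / ‖w - u‖)) := by
  have hR : 0 < R := hr.trans hrR
  have hd : 0 < ‖w - u‖ := norm_pos_iff.2 (sub_ne_zero.2 hwu)
  have htri : ‖u‖ - r ≤ ‖w - u‖ := by
    have := norm_sub_norm_le u w
    rw [norm_sub_rev] at this
    linarith
  have hnum : ‖(R : ℂ) ^ 2 - conj u * w‖ ≤ 2 * R ^ 2 := by
    refine (norm_sub_le _ _).trans ?_
    simp only [norm_pow, norm_mul, norm_real, norm_conj, Real.norm_eq_abs, abs_of_pos hR]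
    nlinarith [norm_nonneg u, norm_nonneg w]
  have hnum₀ : 0 < ‖(R : ℂ) ^ 2 - conj u * w‖ := by
    have h := norm_sq_sub_conj_mul R u w
    by_contra! h0
    have h0' : ‖(R : ℂ) ^ 2 - conj u * w‖ = 0 := le_antisymm h0 (norm_nonneg _)
    rw [h0'] at h
    have := mul_nonneg (by nlinarith [norm_nonneg u] : 0 ≤ R ^ 2 - ‖u‖ ^ 2)
      (by nlinarith [norm_nonneg w] : 0 ≤ R ^ 2 - ‖w‖ ^ 2)
    nlinarith [mul_pos hR hd]
  set M := max r ‖u‖ with hMdef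
  have hrM : r ≤ M := le_max_left _ _
  have hM : 0 < M := hr.trans_le hrM
  have hMR : M ≤ (R + r) / 2 := max_le (by linarith) hnear
  set m := max r ‖w - u‖ with hmdef
  have hm : M / 2 ≤ m := by
    have h₁ : r ≤ m := le_max_left _ _
    have h₂ : ‖w - u‖ ≤ m := le_max_right _ _
    have : M ≤ 2 * m := max_le (by linarith) (by linarith)
    linarith
  have hm₀ : 0 < m := by linarith
  have hlog : Real.log ‖canonicalFactor R u w‖ ≤
      Real.log (R / M) + Real.log 4 + Real.posLog (r / ‖w - u‖) := by
    have hpos : Real.log (m / ‖w - u‖) ≤ Real.posLog (r / ‖w - u‖) := by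
      rcases le_total r ‖w - u‖ with h | h
      · rw [hmdef, max_eq_right h, div_self hd.ne', Real.log_one]
        exact Real.posLog_nonneg
      · rw [hmdef, max_eq_left h]
        exact le_max_right _ _
    calc Real.log ‖canonicalFactor R u w‖ ≤ Real.log (R / M * 4 * (m / ‖w - u‖)) := by
          rw [canonicalFactor_apply, norm_div, norm_mul, norm_real, Real.norm_eq_abs,
            abs_of_pos hR]
          apply Real.log_le_log (by positivity)
          calc _ ≤ 2 * R ^ 2 / (R * ‖w - u‖) := by gcongr
            _ = R / M * 4 * (M / 2 / ‖w - u‖) := by field_simp; ring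
            _ ≤ _ := by gcongr
      _ = Real.log (R / M) + Real.log 4 + Real.log (m / ‖w - u‖) := by
          rw [Real.log_mul (by positivity) (by positivity),
            Real.log_mul (by positivity) (by positivity)]
      _ ≤ _ := by linarith
  have hA := two_mul_sub_div_add_le_log hM (by linarith : M ≤ R)
  have hK : 1 ≤ (R + r) / (R - r) := by rw [one_le_div (by linarith)]; linarith
  -- The lower bound decreases in `M`; at the extreme `M = (R + r) / 2` it equals `2 (R + r) / (3 R
  -- + r)`, which exceeds `2 / 3`.
  have hKA : 2 / 3 ≤ (R + r) / (R - r) * Real.log (R / M) := by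
    refine le_trans ?_ (mul_le_mul_of_nonneg_left hA (by linarith))
    rw [div_mul_div_comm, div_le_div_iff₀ (by norm_num)
      (mul_pos (by linarith) (by linarith))]
    nlinarith [mul_nonneg (by linarith : 0 ≤ R - r) (by linarith : 0 ≤ (R + r) / 2 - M),
      mul_pos hR hr, mul_nonneg hR.le (by linarith : 0 ≤ (R + r) / 2 - M),
      mul_nonneg hr.le (by linarith : 0 ≤ (R + r) / 2 - M), mul_pos hr hr,
      mul_pos hr (by linarith : 0 < R - r)]
  have hA₀ : 0 ≤ Real.log (R / M) := Real.log_nonneg (by rw [one_le_div hM]; linarith)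
  have hp : 0 ≤ Real.posLog (r / ‖w - u‖) := Real.posLog_nonneg
  have h4 := log_four_lt
  have hAK : Real.log (R / M) ≤ (R + r) / (R - r) * Real.log (R / M) :=
    le_mul_of_one_le_left hA₀ hK
  nlinarith

/-- The Green function of the disc of radius `R` with pole `u`, on the disc of radius `r`. -/
lemma log_norm_canonicalFactor_le {r R : ℝ} {u w : ℂ} (hrR : r < R) (hr : 0 < r)
    (hw : ‖w‖ ≤ r) (hu : ‖u‖ ≤ R) (hwu : w ≠ u) :
    Real.log ‖canonicalFactor R u w‖ ≤ 5 * ((R + r) / (R - r)) * Real.log (R / max r ‖u‖) *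
      (1 + Real.posLog (r / ‖w - u‖)) := by
  rcases le_total ‖u‖ ((R + r) / 2) with h | h
  · exact log_norm_canonicalFactor_le_of_near hrR hr hw h hwu
  · have hru : r ≤ ‖u‖ := by linarith
    rw [max_eq_right hru]
    refine (log_norm_canonicalFactor_le_of_far hrR hr hw hu h).trans ?_
    refine le_mul_of_one_le_right (mul_nonneg (mul_nonneg (by norm_num)
      (div_nonneg (by linarith) (by linarith)))
      (Real.log_nonneg (by rwa [one_le_div (by linarith)]))) ?_
    linarith [Real.posLog_nonneg (x := r / ‖w - u‖)]

/-! ### The counting functions of poles -/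

lemma poleMultiplicity_eq_zero_of_notMem {R : ℝ} {f : ℂ → ℂ} {u : ℂ}
    (hf : MeromorphicOn f (closedBall 0 R)) (hu : u ∈ closedBall 0 R)
    (hu' : u ∉ divisorSupport R f) : poleMultiplicity f u = 0 := by
  rw [mem_divisorSupport, not_not, MeromorphicOn.divisor_apply hf hu] at hu'
  simp [poleMultiplicity, hu']

lemma poleCount_eq_sum {R t : ℝ} {f : ℂ → ℂ} (hf : MeromorphicOn f (closedBall 0 R))
    (ht : t ≤ R) :
    poleCount t f = ∑ u ∈ divisorSupport R f, if ‖u‖ ≤ t then poleMultiplicity f u else 0 := by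
  rw [poleCount, ← Finset.sum_filter]
  refine finsum_mem_eq_sum_of_inter_support_eq _ (Set.ext fun u ↦ ?_)
  simp only [Set.mem_inter_iff, mem_closedBall, dist_zero_right, Function.mem_support,
    Finset.coe_filter, Set.mem_ofPred_eq]
  refine ⟨fun ⟨h₁, h₂⟩ ↦ ⟨⟨?_, h₁⟩, h₂⟩, fun ⟨⟨_, h₁⟩, h₂⟩ ↦ ⟨h₁, h₂⟩⟩
  by_contra h
  exact h₂ (poleMultiplicity_eq_zero_of_notMem hf (by simpa using h₁.trans ht) h)

lemma Ioc_inter_Ici_eq_Icc {a ρ : ℝ} (ha : 0 < a) : Set.Ioc 0 ρ ∩ Set.Ici a = Set.Icc a ρ := by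
  ext t
  simp only [Set.mem_inter_iff, Set.mem_Ioc, Set.mem_Ici, Set.mem_Icc]
  exact ⟨fun h ↦ ⟨h.2, h.1.2⟩, fun h ↦ ⟨⟨ha.trans_le h.1, h.2⟩, h.1⟩⟩

lemma integrableOn_inv_Icc {a ρ : ℝ} (ha : 0 < a) :
    IntegrableOn (fun t : ℝ ↦ t⁻¹) (Set.Icc a ρ) :=
  (continuousOn_id.inv₀ fun _ ht ↦ (ha.trans_le ht.1).ne').integrableOn_Icc

lemma setIntegral_inv_Icc {a ρ : ℝ} (ha : 0 < a) (hρ : 0 < ρ) :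
    ∫ t in Set.Icc a ρ, t⁻¹ = Real.posLog (ρ / a) := by
  rcases le_total a ρ with h | h
  · rw [integral_Icc_eq_integral_Ioc, ← intervalIntegral.integral_of_le h,
      integral_inv_of_pos ha hρ, Real.posLog_eq_log]
    rwa [abs_of_pos (by positivity), one_le_div ha]
  · rw [integral_Icc_eq_integral_Ioc, Set.Ioc_eq_empty (not_lt.2 h), setIntegral_empty, eq_comm,
      Real.posLog_eq_zero_iff, abs_of_pos (by positivity), div_le_one ha]
    exact h

lemma intervalIntegrable_indicator_inv {a ρ : ℝ} (ha : 0 < a) (hρ : 0 < ρ) :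
    IntervalIntegrable ((Set.Ici a).indicator fun t : ℝ ↦ t⁻¹) volume 0 ρ := by
  rw [intervalIntegrable_iff_integrableOn_Ioc_of_le hρ.le, IntegrableOn,
    integrable_indicator_iff measurableSet_Ici, IntegrableOn,
    Measure.restrict_restrict measurableSet_Ici, Set.inter_comm, Ioc_inter_Ici_eq_Icc ha]
  exact integrableOn_inv_Icc ha

lemma integral_indicator_inv {a ρ : ℝ} (ha : 0 < a) (hρ : 0 < ρ) :
    ∫ t in (0 : ℝ)..ρ, (Set.Ici a).indicator (fun t : ℝ ↦ t⁻¹) t = Real.posLog (ρ / a) := by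
  rw [intervalIntegral.integral_of_le hρ.le, setIntegral_indicator measurableSet_Ici,
    Ioc_inter_Ici_eq_Icc ha, setIntegral_inv_Icc ha hρ]

/-- A pole `u ≠ 0` is counted for `t ≥ ‖u‖` only, so it contributes the integral of `1 / t` from
`‖u‖` to `ρ`. Zeros of `f` in the index set carry weight `0`. -/
lemma poleCounting_eq_sum {R ρ : ℝ} {f : ℂ → ℂ} (hf : MeromorphicOn f (closedBall 0 R))
    (hρ : 0 < ρ) (hρR : ρ ≤ R) :
    poleCounting ρ f = ∑ u ∈ divisorSupport R f, (poleMultiplicity f u : ℝ) *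
      (if u = 0 then Real.log ρ else Real.posLog (ρ / ‖u‖)) := by
  classical
  have h0 : (poleCount 0 f : ℝ) =
      ∑ u ∈ divisorSupport R f, if u = 0 then (poleMultiplicity f u : ℝ) else 0 := by
    rw [poleCount_eq_sum hf (hρ.le.trans hρR)]
    push_cast
    simp
  have hint : ∫ t in (0 : ℝ)..ρ, ((poleCount t f : ℝ) - (poleCount 0 f : ℝ)) / t =
      ∫ t in (0 : ℝ)..ρ, ∑ u ∈ (divisorSupport R f).filter (· ≠ 0), (poleMultiplicity f u : ℝ) *
        (Set.Ici ‖u‖).indicator (fun t : ℝ ↦ t⁻¹) t := by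
    refine intervalIntegral.integral_congr_ae (ae_of_all _ fun t ht ↦ ?_)
    rw [Set.uIoc_of_le hρ.le] at ht
    rw [h0, poleCount_eq_sum hf (ht.2.trans hρR), Finset.sum_filter]
    push_cast
    rw [← Finset.sum_sub_distrib, Finset.sum_div]
    refine Finset.sum_congr rfl fun u _ ↦ ?_
    by_cases hu : u = 0
    · simp [hu, ht.1.le]
    · by_cases hut : ‖u‖ ≤ t
      · simp [hu, hut, div_eq_mul_inv]
      · simp [hu, hut]
  have hpos : ∀ u ∈ (divisorSupport R f).filter (· ≠ 0), 0 < ‖u‖ := fun u hu ↦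
    norm_pos_iff.2 (Finset.mem_filter.1 hu).2
  rw [poleCounting, hint, intervalIntegral.integral_finsetSum fun u hu ↦
    (intervalIntegrable_indicator_inv (hpos u hu) hρ).const_mul _, h0, Finset.sum_mul,
    Finset.sum_congr rfl fun u hu ↦ by
      rw [intervalIntegral.integral_const_mul, integral_indicator_inv (hpos u hu) hρ],
    Finset.sum_filter, ← Finset.sum_add_distrib]
  refine Finset.sum_congr rfl fun u _ ↦ ?_
  by_cases hu : u = 0 <;> simp [hu]

/-- The difference `T(R, f) - N(r, f)` as a sum over the poles of `f`. -/
lemma nevanlinnaT_sub_poleCounting {r R : ℝ} {f : ℂ → ℂ} (hr : 0 < r) (hrR : r < R)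
    (hf : MeromorphicOn f (closedBall 0 R)) :
    nevanlinnaT R f - poleCounting r f = circleAverage (fun z ↦ Real.posLog ‖f z‖) 0 R +
      ∑ u ∈ divisorSupport R f, (poleMultiplicity f u : ℝ) * Real.log (R / max r ‖u‖) := by
  rw [nevanlinnaT, poleCounting_eq_sum hf (hr.trans hrR) le_rfl, poleCounting_eq_sum hf hr hrR.le,
    add_sub_assoc, ← Finset.sum_sub_distrib]
  congr 1
  refine Finset.sum_congr rfl fun u hu ↦ ?_
  have huR : ‖u‖ ≤ R := by simpa using mem_closedBall_of_mem_divisorSupport hu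
  have hR := hr.trans hrR
  rw [← mul_sub]
  congr 1
  split_ifs with h
  · rw [h, norm_zero, max_eq_left hr.le, Real.log_div hR.ne' hr.ne']
  · have hu₀ : 0 < ‖u‖ := norm_pos_iff.2 h
    rw [Real.posLog_eq_log (x := R / ‖u‖)
      (by rw [abs_of_pos (by positivity)]; rwa [one_le_div hu₀])]
    -- A pole inside the smaller disc is counted by both terms and `‖u‖` cancels; outside it, only
    -- the term at `R` counts it.
    rcases le_total ‖u‖ r with h' | h'
    · rw [Real.posLog_eq_log (by rw [abs_of_pos (by positivity)]; rwa [one_le_div hu₀]),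
        max_eq_left h', Real.log_div hR.ne' hu₀.ne', Real.log_div hr.ne' hu₀.ne',
        Real.log_div hR.ne' hr.ne']
      ring
    · rw [(Real.posLog_eq_zero_iff _).2
        (by rw [abs_of_pos (by positivity)]; rwa [div_le_one hu₀]), max_eq_right h', sub_zero]

/-! ### The radial counting function of a measure -/

lemma setLIntegral_inv_Icc {a ρ : ℝ} (ha : 0 < a) (hρ : 0 < ρ) :
    ∫⁻ t in Set.Icc a ρ, (ENNReal.ofReal t)⁻¹ = ENNReal.ofReal (Real.posLog (ρ / a)) := by
  rw [← setIntegral_inv_Icc ha hρ, ofReal_integral_eq_lintegral_ofReal (integrableOn_inv_Icc ha)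
    ((ae_restrict_iff' measurableSet_Icc).2
      (ae_of_all _ fun t ht ↦ inv_nonneg.2 (ha.le.trans ht.1)))]
  exact setLIntegral_congr_fun measurableSet_Icc fun t ht ↦
    (ENNReal.ofReal_inv_of_pos (ha.trans_le ht.1)).symm

/-- Only radii `t ≥ d` are kept, and there the mass is at least that of the disc of radius `d`.
Small `d` excludes atoms; `d = s / e` bounds the mass of a disc. -/
lemma measure_mul_posLog_le_measureCounting (μ : Measure ℂ) (z : ℂ) {d s : ℝ} (hd : 0 < d)
    (hs : 0 < s) :
    μ (closedBall z d) * ENNReal.ofReal (Real.posLog (s / d)) ≤ measureCounting μ z s := by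
  rw [← setLIntegral_inv_Icc hd hs, measureCounting, ← lintegral_const_mul _ (by fun_prop)]
  calc ∫⁻ t in Set.Icc d s, μ (closedBall z d) * (ENNReal.ofReal t)⁻¹
      ≤ ∫⁻ t in Set.Icc d s, μ (closedBall z t) / ENNReal.ofReal t := by
        refine setLIntegral_mono' measurableSet_Icc fun t ht ↦ ?_
        rw [div_eq_mul_inv]
        gcongr
        exact ht.1
    _ ≤ _ := lintegral_mono_set (Set.Icc_subset_Ioc hd le_rfl)

lemma measure_singleton_eq_zero_of_measureCounting_lt_top {μ : Measure ℂ} {z : ℂ} {s : ℝ}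
    (hs : 0 < s) (h : measureCounting μ z s < ∞) : μ {z} = 0 := by
  by_contra hne
  obtain ⟨n, hn⟩ := ENNReal.exists_nat_mul_gt hne h.ne
  -- This radius makes the logarithm equal to `n`, so an atom would force `n * μ {z}` below the
  -- counting function for every `n`.
  have hle := measure_mul_posLog_le_measureCounting μ z (d := s * Real.exp (-n))
    (by positivity) hs
  have hlog : Real.posLog (s / (s * Real.exp (-n))) = n := by
    rw [div_mul_cancel_left₀ hs.ne', Real.exp_neg, inv_inv, Real.posLog_apply, Real.log_exp,
      max_eq_right (Nat.cast_nonneg n)]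
  rw [hlog, ENNReal.ofReal_natCast, mul_comm] at hle
  refine absurd (hn.trans_le ((mul_le_mul_right (measure_mono ?_) _).trans hle)) (lt_irrefl _)
  simpa using (by positivity : 0 ≤ s * Real.exp (-n))

/-- The logarithmic potential is bounded by the radial counting function. -/
lemma lintegral_posLog_le_measureCounting (μ : Measure ℂ) [SFinite μ] (b : ℂ) {s : ℝ}
    (hs : 0 < s) :
    ∫⁻ w, ENNReal.ofReal (Real.posLog (s / ‖w - b‖)) ∂μ ≤ measureCounting μ b s := by
  classical
  let k : ℂ → ℝ → ℝ≥0∞ := fun w t ↦ if ‖w - b‖ ≤ t then (ENNReal.ofReal t)⁻¹ else 0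
  have hk : Measurable (Function.uncurry k) := by
    refine Measurable.ite (measurableSet_le (by fun_prop) (by fun_prop)) (by fun_prop)
      measurable_const
  have hμ : measureCounting μ b s = ∫⁻ t in Set.Ioc 0 s, ∫⁻ w, k w t ∂μ := by
    refine lintegral_congr fun t ↦ ?_
    have : (fun w ↦ k w t) = (closedBall b t).indicator fun _ ↦ (ENNReal.ofReal t)⁻¹ := by
      ext w
      simp [k, Set.indicator_apply, dist_eq_norm]
    rw [this, lintegral_indicator_const measurableSet_closedBall, mul_comm, div_eq_mul_inv]
  rw [hμ, ← lintegral_lintegral_swap hk.aemeasurable]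
  refine lintegral_mono fun w ↦ ?_
  -- At `w = b` the integrand is `0`, since `s / 0 = 0`, and not `∞`; hence only an inequality.
  rcases eq_or_ne w b with rfl | hwb
  · simp
  have hd : 0 < ‖w - b‖ := norm_pos_iff.2 (sub_ne_zero.2 hwb)
  rw [← setLIntegral_inv_Icc hd hs]
  calc ∫⁻ t in Set.Icc ‖w - b‖ s, (ENNReal.ofReal t)⁻¹ = ∫⁻ t in Set.Icc ‖w - b‖ s, k w t :=
        setLIntegral_congr_fun measurableSet_Icc fun t ht ↦ by simp [k, ht.1]
    _ ≤ _ := lintegral_mono_set (Set.Icc_subset_Ioc hd le_rfl)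

lemma measureCounting_le_add (μ : Measure ℂ) (z : ℂ) {ε s : ℝ} (hε : 0 < ε) :
    measureCounting μ z s ≤
      measureCounting μ z ε + μ Set.univ / ENNReal.ofReal ε * ENNReal.ofReal s := by
  calc measureCounting μ z s
      ≤ ∫⁻ t in Set.Ioc 0 ε ∪ Set.Ioc ε s, μ (closedBall z t) / ENNReal.ofReal t :=
        lintegral_mono_set Set.Ioc_subset_Ioc_union_Ioc
    _ ≤ _ := (lintegral_union_le _ _ _).trans (add_le_add_right ?_ _)
  calc ∫⁻ t in Set.Ioc ε s, μ (closedBall z t) / ENNReal.ofReal t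
      ≤ ∫⁻ _ in Set.Ioc ε s, μ Set.univ / ENNReal.ofReal ε := by
        refine setLIntegral_mono' measurableSet_Ioc fun t ht ↦ ?_
        gcongr
        · exact Set.subset_univ _
        · exact ht.1.le
    _ ≤ _ := by
        rw [setLIntegral_const, Real.volume_Ioc]
        gcongr
        linarith

lemma isFiniteMeasure_of_iSup_measureCounting_lt_top {μ : Measure ℂ} {r r₀ R : ℝ} (hr₀ : 0 < r₀)
    (hrR : r < R) (hμ : μ (closedBall (0 : ℂ) r)ᶜ = 0)
    (h : (⨆ z ∈ closedBall (0 : ℂ) R, measureCounting μ z r₀) < ∞) : IsFiniteMeasure μ := by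
  have hball : μ (closedBall (0 : ℂ) r) < ∞ := by
    refine (isCompact_closedBall _ _).measure_lt_top_of_nhdsWithin fun z hz ↦ ?_
    refine Measure.FiniteAtFilter.filter_mono nhdsWithin_le_nhds
      ⟨closedBall z (r₀ / Real.exp 1), closedBall_mem_nhds _ (by positivity), ?_⟩
    have hle := measure_mul_posLog_le_measureCounting μ z (d := r₀ / Real.exp 1)
      (by positivity) hr₀
    rw [div_div_cancel₀ hr₀.ne', Real.posLog_apply, Real.log_exp, max_eq_right zero_le_one,
      ENNReal.ofReal_one, mul_one] at hle
    refine (hle.trans ?_).trans_lt h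
    exact le_biSup (fun z ↦ measureCounting μ z r₀) (closedBall_subset_closedBall hrR.le hz)
  refine ⟨?_⟩
  rw [← Set.union_compl_self (closedBall (0 : ℂ) r)]
  refine (measure_union_le _ _).trans_lt ?_
  rwa [hμ, add_zero]

/-- A uniform bound for the radial counting function at some radius and on some disc larger than
the one carrying `μ` gives a uniform bound at every radius and on the whole plane. -/
lemma iSup_measureCounting_lt_top {μ : Measure ℂ} {r r₀ R : ℝ} (hr₀ : 0 < r₀)
    (hrR : r < R) (hμ : μ (closedBall (0 : ℂ) r)ᶜ = 0)
    (h : (⨆ z ∈ closedBall (0 : ℂ) R, measureCounting μ z r₀) < ∞) (s : ℝ) :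
    (⨆ z, measureCounting μ z s) < ∞ := by
  have := isFiniteMeasure_of_iSup_measureCounting_lt_top hr₀ hrR hμ h
  -- A disc of radius at most `(R - r) / 2` centred outside the disc of radius `R` misses the disc
  -- carrying `μ`, so such centres contribute nothing up to radius `ε`.
  set ε := min r₀ ((R - r) / 2) with hε
  have hε₀ : 0 < ε := lt_min hr₀ (by linarith)
  refine (iSup_le fun z ↦ (measureCounting_le_add μ z hε₀).trans
    (add_le_add_left (?_ : _ ≤ ⨆ z ∈ closedBall (0 : ℂ) R, measureCounting μ z r₀) _)).trans_lt
    (ENNReal.add_lt_top.2 ⟨h, ENNReal.mul_lt_top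
      (ENNReal.div_lt_top (measure_ne_top _ _) (by simpa using hε₀)) ENNReal.ofReal_lt_top⟩)
  by_cases hz : z ∈ closedBall (0 : ℂ) R
  · refine le_trans ?_ (le_biSup (fun z ↦ measureCounting μ z r₀) hz)
    exact lintegral_mono_set (Set.Ioc_subset_Ioc_right (min_le_left _ _))
  · refine le_of_eq_of_le ?_ zero_le
    rw [measureCounting, setLIntegral_congr_fun (g := fun _ ↦ 0) measurableSet_Ioc, lintegral_zero]
    intro t ht
    have ht' : t ≤ (R - r) / 2 := ht.2.trans (min_le_right _ _)
    have : μ (closedBall z t) = 0 := by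
      refine measure_mono_null (Set.subset_compl_iff_disjoint_right.2 ?_) hμ
      refine Set.disjoint_left.2 fun w hw hw' ↦ hz ?_
      rw [mem_closedBall] at hw hw' ⊢
      have := dist_triangle_left z 0 w
      linarith
    simp [this]

/-! ### Measurability and integrability of `log⁺ |f|` -/

lemma mem_divisorSupport_of_order_neg {R : ℝ} {f : ℂ → ℂ} {u : ℂ}
    (hf : MeromorphicOn f (closedBall 0 R)) (hu : u ∈ closedBall 0 R)
    (h : meromorphicOrderAt f u < 0) : u ∈ divisorSupport R f := by
  rw [mem_divisorSupport, MeromorphicOn.divisor_apply hf hu]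
  intro h0
  rcases WithTop.untop₀_eq_zero.1 h0 with h' | h' <;> simp [h'] at h

lemma logPlusAbs_eq_of_notMem {R : ℝ} {f : ℂ → ℂ} {z : ℂ}
    (hf : MeromorphicOn f (closedBall 0 R)) (hz : z ∈ closedBall 0 R)
    (hz' : z ∉ divisorSupport R f) :
    logPlusAbs f z = ENNReal.ofReal (Real.posLog ‖toMeromorphicNFAt f z z‖) :=
  if_neg fun h ↦ hz' (mem_divisorSupport_of_order_neg hf hz h)

/-- Off the finite null set of zeros and poles, `logPlusAbs f` is continuous. The pointwise normal
forms are the values of a single function there, `toMeromorphicNFOn f`. -/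
lemma aemeasurable_logPlusAbs {r R : ℝ} {f : ℂ → ℂ} {μ : Measure ℂ} (hrR : r < R)
    (hf : MeromorphicOn f (closedBall 0 R)) (hμ : μ (divisorSupport R f) = 0) :
    AEMeasurable (logPlusAbs f) (μ.restrict (closedBall 0 r)) := by
  set S : Set ℂ := ↑(divisorSupport R f)
  have hS : MeasurableSet (closedBall (0 : ℂ) r \ S) :=
    measurableSet_closedBall.diff (divisorSupport R f).measurableSet
  rw [← Measure.restrict_congr_set (sdiff_null_ae_eq_self hμ)]
  set g := toMeromorphicNFOn f (closedBall 0 R)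
  have hg : ContinuousOn g (closedBall (0 : ℂ) r \ S) := fun z hz ↦ by
    have hzR : z ∈ closedBall (0 : ℂ) R := closedBall_subset_closedBall hrR.le hz.1
    have hnf := meromorphicNFOn_toMeromorphicNFOn f (closedBall 0 R) hzR
    refine ContinuousAt.continuousWithinAt (AnalyticAt.continuousAt (𝕜 := ℂ) ?_)
    rw [← hnf.meromorphicOrderAt_nonneg_iff_analyticAt, meromorphicOrderAt_toMeromorphicNFOn hf hzR]
    exact not_lt.1 fun h ↦ hz.2 (mem_divisorSupport_of_order_neg hf hzR h)
  have hcont : ContinuousOn (fun z ↦ ENNReal.ofReal (Real.posLog ‖g z‖))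
      (closedBall (0 : ℂ) r \ S) :=
    ENNReal.continuous_ofReal.comp_continuousOn
      (Real.continuous_posLog.comp_continuousOn hg.norm)
  refine (hcont.aemeasurable hS).congr ((ae_restrict_iff' hS).2 (ae_of_all _ fun z hz ↦ ?_))
  have hzR : z ∈ closedBall (0 : ℂ) R := closedBall_subset_closedBall hrR.le hz.1
  rw [logPlusAbs_eq_of_notMem hf hzR hz.2]
  simp only [g, toMeromorphicNFOn_eq_toMeromorphicNFAt hf hzR]

/-- The pointwise bound is integrated pole by pole. Each pole brings the total mass of the disc plus
its logarithmic potential; the weights `c u`, together with `5 * K * m`, add up to the stated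
factor. -/
lemma lintegral_logPlusAbs_le {r R : ℝ} {f : ℂ → ℂ} {μ : Measure ℂ} [SFinite μ] (hr : 0 < r)
    (hrR : r < R) (hf : MeromorphicOn f (closedBall 0 R)) (hμ : μ (divisorSupport R f) = 0) :
    ∫⁻ z in closedBall (0 : ℂ) r, logPlusAbs f z ∂μ ≤
      ENNReal.ofReal (5 * ((R + r) / (R - r)) * (nevanlinnaT R f - poleCounting r f)) *
        (μ (closedBall 0 r) + ⨆ z ∈ closedBall (0 : ℂ) R, measureCounting μ z r) := by
  set K := (R + r) / (R - r) with hK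
  set N := ⨆ z ∈ closedBall (0 : ℂ) R, measureCounting μ z r
  set m := circleAverage (fun z ↦ Real.posLog ‖f z‖) 0 R
  have hK₀ : 0 ≤ K := div_nonneg (by linarith) (by linarith)
  have hm₀ : 0 ≤ m := circleAverage_nonneg_of_nonneg fun _ _ ↦ Real.posLog_nonneg
  let c : ℂ → ℝ := fun u ↦ 5 * K * (poleMultiplicity f u * Real.log (R / max r ‖u‖))
  have hc : ∀ u ∈ divisorSupport R f, 0 ≤ c u := fun u hu ↦ by
    have huR : ‖u‖ ≤ R := by simpa using mem_closedBall_of_mem_divisorSupport hu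
    have : 0 ≤ Real.log (R / max r ‖u‖) := by
      apply Real.log_nonneg
      rw [one_le_div (hr.trans_le (le_max_left _ _))]
      exact max_le hrR.le huR
    positivity
  have hT : ENNReal.ofReal (5 * K * (nevanlinnaT R f - poleCounting r f)) =
      ENNReal.ofReal (5 * K * m) + ∑ u ∈ divisorSupport R f, ENNReal.ofReal (c u) := by
    rw [nevanlinnaT_sub_poleCounting hr hrR hf, mul_add, Finset.mul_sum,
      ENNReal.ofReal_add (by positivity) (Finset.sum_nonneg hc), ENNReal.ofReal_sum_of_nonneg hc]
  have hae : ∀ᵐ w ∂μ.restrict (closedBall 0 r), logPlusAbs f w ≤ ENNReal.ofReal (5 * K * m) +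
      ∑ u ∈ divisorSupport R f, ENNReal.ofReal (c u) *
        (1 + ENNReal.ofReal (Real.posLog (r / ‖w - u‖))) := by
    filter_upwards [ae_restrict_mem measurableSet_closedBall,
      ae_restrict_of_ae (measure_eq_zero_iff_ae_notMem.1 hμ)] with w hw hwS
    have hwr : ‖w‖ ≤ r := by simpa using hw
    rw [logPlusAbs_eq_of_notMem hf (closedBall_subset_closedBall hrR.le hw) hwS]
    have hterm : ∀ u, ENNReal.ofReal (c u) * (1 + ENNReal.ofReal (Real.posLog (r / ‖w - u‖))) =
        ENNReal.ofReal (c u * (1 + Real.posLog (r / ‖w - u‖))) := fun u ↦ by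
      rw [← ENNReal.ofReal_one, ← ENNReal.ofReal_add zero_le_one Real.posLog_nonneg,
        ← ENNReal.ofReal_mul' (add_nonneg zero_le_one Real.posLog_nonneg)]
    have hpos : ∀ u ∈ divisorSupport R f, 0 ≤ c u * (1 + Real.posLog (r / ‖w - u‖)) := fun u hu ↦
      mul_nonneg (hc u hu) (add_nonneg zero_le_one Real.posLog_nonneg)
    simp only [hterm]
    rw [← ENNReal.ofReal_sum_of_nonneg hpos,
      ← ENNReal.ofReal_add (by positivity) (Finset.sum_nonneg hpos)]
    refine ENNReal.ofReal_le_ofReal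
      ((posLog_norm_toMeromorphicNFAt_le hrR hf hw).trans (add_le_add ?_ ?_))
    · exact mul_le_mul_of_nonneg_right (by linarith) hm₀
    · refine Finset.sum_le_sum fun u hu ↦ ?_
      have huR : ‖u‖ ≤ R := by simpa using mem_closedBall_of_mem_divisorSupport hu
      have hwu : w ≠ u := fun h ↦ hwS (h ▸ hu)
      have := mul_le_mul_of_nonneg_left (log_norm_canonicalFactor_le hrR hr hwr huR hwu)
        (Nat.cast_nonneg (α := ℝ) (poleMultiplicity f u))
      refine this.trans_eq ?_
      simp only [c]
      ring
  refine (lintegral_mono_ae hae).trans ?_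
  have hmeas : ∀ u : ℂ, Measurable fun w : ℂ ↦ ENNReal.ofReal (Real.posLog (r / ‖w - u‖)) :=
    fun u ↦ ENNReal.measurable_ofReal.comp
      (Real.continuous_posLog.measurable.comp (by fun_prop))
  have hmeas' : ∀ u : ℂ,
      Measurable fun w : ℂ ↦ 1 + ENNReal.ofReal (Real.posLog (r / ‖w - u‖)) :=
    fun u ↦ measurable_const.add (hmeas u)
  rw [lintegral_add_left measurable_const, lintegral_const, Measure.restrict_apply_univ,
    lintegral_finsetSum _ fun u _ ↦ (hmeas' u).const_mul _, hT, add_mul,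
    Finset.sum_mul]
  gcongr with u hu
  · exact le_self_add
  · rw [lintegral_const_mul _ (hmeas' u),
      lintegral_add_left measurable_const, lintegral_one, Measure.restrict_apply_univ]
    gcongr
    calc _ ≤ ∫⁻ w, ENNReal.ofReal (Real.posLog (r / ‖w - u‖)) ∂μ := setLIntegral_le_lintegral _ _
      _ ≤ measureCounting μ u r := lintegral_posLog_le_measureCounting μ u hr
      _ ≤ N := le_biSup (fun z ↦ measureCounting μ z r) (mem_closedBall_of_mem_divisorSupport hu)

/-! ### Constant functions and the equivalence -/

lemma poleMultiplicity_const (c z : ℂ) : poleMultiplicity (fun _ ↦ c) z = 0 := by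
  rw [poleMultiplicity, meromorphicOrderAt_const]
  split_ifs <;> rfl

lemma poleCounting_const (c : ℂ) (s : ℝ) : poleCounting s (fun _ ↦ c) = 0 := by
  simp [poleCounting, poleCount, poleMultiplicity_const]

lemma nevanlinnaT_const (c : ℂ) (s : ℝ) : nevanlinnaT s (fun _ ↦ c) = Real.posLog ‖c‖ := by
  rw [nevanlinnaT, poleCounting_const, circleAverage_const, add_zero]

end Nevanlinna

end

theorem mainTheorem2 (r : ℝ) (hr : 0 < r) (μ : MeasureTheory.Measure ℂ)
    (hμ : μ (Metric.closedBall (0 : ℂ) r)ᶜ = 0) :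
    (∃ r₀ : ℝ, 0 < r₀ ∧ ∃ R : ℝ, r < R ∧
      (⨆ z ∈ Metric.closedBall (0 : ℂ) R, Nevanlinna.measureCounting μ z r₀) < ∞) ↔
    (∀ R : ℝ, r < R → ∀ f : ℂ → ℂ, MeromorphicOn f (Metric.closedBall (0 : ℂ) R) →
      AEMeasurable (Nevanlinna.logPlusAbs f) (μ.restrict (Metric.closedBall (0 : ℂ) r)) ∧
      (∫⁻ z in Metric.closedBall (0 : ℂ) r, Nevanlinna.logPlusAbs f z ∂μ) < ∞ ∧
      (∫⁻ z in Metric.closedBall (0 : ℂ) r, Nevanlinna.logPlusAbs f z ∂μ) ≤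
        ENNReal.ofReal
          (5 * ((R + r) / (R - r)) * (Nevanlinna.nevanlinnaT R f - Nevanlinna.poleCounting r f)) *
        (μ (Metric.closedBall (0 : ℂ) r) +
          ⨆ z ∈ Metric.closedBall (0 : ℂ) R, Nevanlinna.measureCounting μ z r) ∧
      ENNReal.ofReal
          (5 * ((R + r) / (R - r)) * (Nevanlinna.nevanlinnaT R f - Nevanlinna.poleCounting r f)) *
        (μ (Metric.closedBall (0 : ℂ) r) +
          ⨆ z ∈ Metric.closedBall (0 : ℂ) R, Nevanlinna.measureCounting μ z r) < ∞) := by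
  constructor
  · rintro ⟨r₀, hr₀, R₀, hrR₀, h⟩ R hrR f hf
    have := Nevanlinna.isFiniteMeasure_of_iSup_measureCounting_lt_top hr₀ hrR₀ hμ h
    have hsup := Nevanlinna.iSup_measureCounting_lt_top hr₀ hrR₀ hμ h r
    -- A finite counting function at a point excludes an atom there, and zeros and poles are finite
    -- in number.
    have hnull : μ (Nevanlinna.divisorSupport R f) = 0 :=
      (measure_null_iff_singleton (Finset.countable_toSet _)).2 fun z _ ↦
        Nevanlinna.measure_singleton_eq_zero_of_measureCounting_lt_top hr
          ((le_iSup (fun z ↦ Nevanlinna.measureCounting μ z r) z).trans_lt hsup)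
    have hle := Nevanlinna.lintegral_logPlusAbs_le hr hrR hf hnull
    have hlt : ENNReal.ofReal
          (5 * ((R + r) / (R - r)) * (Nevanlinna.nevanlinnaT R f - Nevanlinna.poleCounting r f)) *
        (μ (Metric.closedBall (0 : ℂ) r) +
          ⨆ z ∈ Metric.closedBall (0 : ℂ) R, Nevanlinna.measureCounting μ z r) < ∞ :=
      ENNReal.mul_lt_top ENNReal.ofReal_lt_top (ENNReal.add_lt_top.2 ⟨measure_lt_top _ _,
        (iSup₂_le fun z _ ↦
          le_iSup (fun z ↦ Nevanlinna.measureCounting μ z r) z).trans_lt hsup⟩)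
    exact ⟨Nevanlinna.aemeasurable_logPlusAbs hrR hf hnull, hle.trans_lt hlt, hle, hlt⟩
  · intro h
    refine ⟨r, hr, r + 1, by linarith, ?_⟩
    -- The constant `e` has `log⁺ = 1` and no poles, so the factor before the supremum is positive
    -- and can be cancelled.
    have hlt := (h (r + 1) (by linarith) (fun _ ↦ Complex.exp 1)
      (fun z _ ↦ MeromorphicAt.const _ z)).2.2.2
    have hnorm : ‖Complex.exp 1‖ = Real.exp 1 := by simp [Complex.norm_exp]
    rw [Nevanlinna.nevanlinnaT_const, Nevanlinna.poleCounting_const, hnorm, Real.posLog_apply,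
      Real.log_exp, max_eq_right zero_le_one] at hlt
    have hpos : ENNReal.ofReal (5 * ((r + 1 + r) / (r + 1 - r)) * (1 - 0)) ≠ 0 := by
      rw [ne_eq, ENNReal.ofReal_eq_zero, not_le, add_sub_cancel_left]
      positivity
    have hsum := ENNReal.lt_top_of_mul_ne_top_right hlt.ne hpos
    exact (ENNReal.add_lt_top.1 hsum).2
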